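/- Let $\mathcal H$ be a complex Hilbert space of functions on a set $X$ with continuous point evaluations (a reproducing kernel Hilbert space), and let $k_a\in\mathcal H$ denote the reproducing kernel at $a\in X$, so that $f(a)=\langle f,k_a\rangle$ for all $f\in\mathcal H$. Assume that $k_a\neq 0$ for every $a\in X$. Put $\mathcal Z_a=\{f\in\mathcal H: f(a)=0\}$ and let $P_{\mathcal S}$ denote the orthogonal projection onto a closed subspace $\mathcal S$. Let $Gr(\mathcal H)$ be the set of closed subspaces of $\mathcal H$, identified with their orthogonal projections. A curve $\gamma:[0,1]\to Gr(\mathcal H)$ is piecewise smooth if $t\mapsto P_{\gamma(t)}$ is piecewise smooth for the operator norm, and its length is $\int_0^1\|\frac{d}{dt}P_{\gamma(t)}\|\,dt$ (operator norm). Let $\Gamma(a,b)$ be the infimum of the lengths of the piecewise smooth curves in $Gr(\mathcal H)$ joining $\mathcal Z_a$ and $\mathcal Z_b$. Let $\check\delta(a,b)$ be the Kobayashi metric, that is, the infimum of $$\int_0^1\left(\|\dot\Phi(t)\|^2-|\langle\dot\Phi(t),\Phi(t)\rangle|^2\right)^{1/2}dt$$ over the curves in the projective space $P(\mathcal H)$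 that join the classes of $k_a/\|k_a\|$ and $k_b/\|k_b\|$ and have a piecewise smooth lift $\Phi$ to the unit sphere of $\mathcal H$. Let $$\delta(a,b)=\left(1-\frac{|\langle k_a,k_b\rangle|^2}{\|k_a\|^2\|k_b\|^2}\right)^{1/2},\qquad \hat\delta(a,b)=\left(1-\frac{|\langle k_a,k_b\rangle|}{\|k_a\|\,\|k_b\|}\right)^{1/2}$$ (the latter is the Skwarczyński metric), and let $\|T\|_p=(\mathrm{Tr}\,|T|^p)^{1/p}$ be the Schatten $p$-norm. Then for all $a,b\in X$: 1. $\check\delta(a,b)=\Gamma(a,b)=\arccos\left(\dfrac{|\langle k_a,k_b\rangle|}{\|k_a\|\,\|k_b\|}\right)$; 2. $\delta(a,b)=\sin\Gamma(a,b)=\|P_{\mathcal Z_a}-P_{\mathcal Z_b}\|=2^{-1/p}\,\|P_{\mathcal Z_a}-P_{\mathcal Z_b}\|_p$ for every real $p\ge 1$; 3. $\hat\delta(a,b)=\sqrt2\,\sin\left(\tfrac12\Gamma(a,b)\right)$. -/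

import Mathlib

noncomputable section

namespace KernelGeometry

open scoped ContDiff ENNReal LinearAlgebra.Projectivization

/-! ### Piecewise smooth curves on `[0, 1]` -/

/-- `γ` is piecewise smooth on `[0, 1]`: there is a partition `0 = t₀ < t₁ < ⋯ < tₙ = 1` such that
`γ` is `C^∞` on every closed interval `[tᵢ, tᵢ₊₁]` (one-sidedly at the endpoints). As the closed
pieces overlap at the breakpoints, `γ` is in particular continuous on `[0, 1]`. -/
def PiecewiseSmooth {E : Type*} [NormedAddCommGroup E] [NormedSpace ℝ E] (γ : ℝ → E) : Prop :=
  ∃ (n : ℕ) (t : Fin (n + 1) → ℝ), StrictMono t ∧ t 0 = 0 ∧ t (Fin.last n) = 1 ∧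
    ∀ i : Fin n, ContDiffOn ℝ ∞ γ (Set.Icc (t i.castSucc) (t i.succ))

section Hilbert

variable {H : Type*} [NormedAddCommGroup H] [InnerProductSpace ℂ H] [CompleteSpace H]

/-! ### The Grassmann manifold of closed subspaces and its Finsler geodesic distance -/

/-- The orthogonal projection `P_S : H → H` onto a closed subspace `S`. -/
def orthProj (S : ClosedSubmodule ℂ H) : H →L[ℂ] H :=
  haveI : CompleteSpace S.toSubmodule := S.isClosed.completeSpace_coe
  S.toSubmodule.starProjection

/-- A curve `γ : [0, 1] → Gr(H)` of closed subspaces is piecewise smooth if its curve of orthogonal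
projections is piecewise smooth for the operator norm (`Gr(H)` is a submanifold of `B(H)`). -/
def GrPiecewiseSmooth (γ : ℝ → ClosedSubmodule ℂ H) : Prop :=
  PiecewiseSmooth fun t => orthProj (γ t)

/-- The Finsler length `∫₀¹ ‖(d/dt) P(t)‖ dt` (operator norm) of a curve in `Gr(H)`. -/
def grLength (γ : ℝ → ClosedSubmodule ℂ H) : ℝ :=
  ∫ t in (0 : ℝ)..1, ‖deriv (fun s => orthProj (γ s)) t‖

/-- The geodesic distance in `Gr(H)`: the infimum of the lengths of the piecewise smooth curves
joining `S` and `T`. -/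
def grDist (S T : ClosedSubmodule ℂ H) : ℝ :=
  sInf {l : ℝ | ∃ γ : ℝ → ClosedSubmodule ℂ H,
    GrPiecewiseSmooth γ ∧ γ 0 = S ∧ γ 1 = T ∧ l = grLength γ}

/-! ### The projective space and its Fubini-Study geodesic distance -/

/-- `Φ` is a piecewise smooth lift of `γ : [0, 1] → P(H)` to the unit sphere of `H`. A curve in
`P(H)` is piecewise smooth if and only if it has such a lift. -/
def IsPiecewiseSmoothLift (γ : ℝ → ℙ ℂ H) (Φ : ℝ → H) : Prop :=
  PiecewiseSmooth Φ ∧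
    ∀ t ∈ Set.Icc (0 : ℝ) 1, ‖Φ t‖ = 1 ∧ ∃ h : Φ t ≠ 0, Projectivization.mk ℂ (Φ t) h = γ t

/-- The Fubini-Study length `∫₀¹ (‖Φ'‖² - |⟨Φ', Φ⟩|²)^{1/2} dt` of the curve in `P(H)` that is
lifted by `Φ`. It does not depend on the lift. -/
def fubiniStudyLength (Φ : ℝ → H) : ℝ :=
  ∫ t in (0 : ℝ)..1, √(‖deriv Φ t‖ ^ 2 - ‖inner ℂ (deriv Φ t) (Φ t)‖ ^ 2)

/-- The geodesic distance of the Fubini-Study metric on `P(H)`: the infimum of the lengths of the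
piecewise smooth curves joining `p` and `q`. -/
def fubiniStudyDist (p q : ℙ ℂ H) : ℝ :=
  sInf {l : ℝ | ∃ (γ : ℝ → ℙ ℂ H) (Φ : ℝ → H),
    IsPiecewiseSmoothLift γ Φ ∧ γ 0 = p ∧ γ 1 = q ∧ l = fubiniStudyLength Φ}

/-! ### Schatten norms -/

/-- The trace `∑ᵢ ⟨A eᵢ, eᵢ⟩ ∈ [0, ∞]` of a positive bounded operator, computed in some Hilbert
basis of `H` (it is the same in all of them). -/
def posTrace (A : H →L[ℂ] H) : ℝ≥0∞ :=
  ∑' i : (exists_hilbertBasis ℂ H).choose, ENNReal.ofReal (inner ℂ (i : H) (A (i : H))).re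

/-- The Schatten `p`-norm `(Tr |T|^p)^{1/p} ∈ [0, ∞]`, where `|T| = (T^* T)^{1/2}`. -/
def schattenNorm (p : ℝ) (T : H →L[ℂ] H) : ℝ≥0∞ :=
  posTrace (CFC.rpow (CFC.abs T) p) ^ (1 / p)

end Hilbert

/-! ### Reproducing kernel Hilbert spaces -/

section Kernel

variable {X : Type*} (H : Type*) [NormedAddCommGroup H] [InnerProductSpace ℂ H] [RKHS ℂ H X ℂ]

/-- The subspace `Z_a = {f ∈ H : f(a) = 0}`, as a point of `Gr(H)`. -/
def zeroSpace (a : X) : ClosedSubmodule ℂ H where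
  carrier := {f : H | f a = 0}
  zero_mem' := by simp
  add_mem' := by
    intro f g hf hg
    simp only [Set.mem_ofPred_eq] at hf hg ⊢
    simp [hf, hg]
  smul_mem' := by
    intro c f hf
    simp only [Set.mem_ofPred_eq] at hf ⊢
    simp [hf]
  isClosed' := isClosed_eq (RKHS.continuous_eval a) continuous_const

variable [CompleteSpace H]

/-- The reproducing kernel `k_a ∈ H` at the point `a`, so that `f(a) = ⟨f, k_a⟩`. -/
def ker (a : X) : H := RKHS.kerFun H a (1 : ℂ)

/-- The reproducing property `f(a) = ⟨f, k_a⟩` (`inner` is linear in its second argument). -/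
theorem inner_ker (a : X) (f : H) : inner ℂ (ker H a) f = f a := by
  simp [ker]

/-- `|⟨k_a, k_b⟩| / (‖k_a‖ ‖k_b‖)`. -/
def cosAngle (a b : X) : ℝ := ‖inner ℂ (ker H a) (ker H b)‖ / (‖ker H a‖ * ‖ker H b‖)

/-- The metric `Γ(a, b) = d(Z_a, Z_b)`. -/
def Gam (a b : X) : ℝ := grDist (zeroSpace H a) (zeroSpace H b)

/-- The metric `δ(a, b) = (1 - (|⟨k_a, k_b⟩| / (‖k_a‖ ‖k_b‖))²)^{1/2}`. -/
def del (a b : X) : ℝ := √(1 - cosAngle H a b ^ 2)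

/-- The Skwarczyński metric `(1 - |⟨k_a, k_b⟩| / (‖k_a‖ ‖k_b‖))^{1/2}`. -/
def skwarczynski (a b : X) : ℝ := √(1 - cosAngle H a b)

/-- The Kobayashi metric: the Fubini-Study geodesic distance between the points of `P(H)` given by
`k_a` and `k_b` (a vector and its normalization give the same point). -/
def kobayashi (hk : ∀ a : X, ker H a ≠ 0) (a b : X) : ℝ :=
  fubiniStudyDist (Projectivization.mk ℂ (ker H a) (hk a))
    (Projectivization.mk ℂ (ker H b) (hk b))

end Kernel

end KernelGeometry

end

/-!
Curves in two different spaces are compared with the same angle `θ = arccos |⟪u, v⟫|`, where `u` and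
`v` are the normalized kernels `k_a / ‖k_a‖` and `k_b / ‖k_b‖`; the subspace `Z_a` is the hyperplane
orthogonal to `u`, with projection `1 - |u⟩⟨u|`.

*Every curve has length at least `θ`.* Fix `u` and follow the quantity `y = cos² (angle to u)` along
the curve: `y = ‖u - P u‖²` for a curve of projections `P` that starts at `Z_a`, and `y = |⟪u, Φ⟫|²`
for a curve `Φ` on the unit sphere that starts at `u`. A tangent vector to the projections is
off-diagonal with respect to `P` (`norm_inner_tangent_le`), and the part of `Φ'` along `Φ` does not
change `y` (`abs_re_conj_mul_inner_le`), so in both cases `|y'| ≤ 2 N √(y (1 - y))`, with `N` the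
integrand of the length. In terms of `ζ = 2 y - 1` this reads `|ζ'| ≤ 2 N √(1 - ζ²)`, that is, the
double angle `arccos ζ` grows at a rate of at most `2 N` (`PiecewiseSmooth.arccos_le_integral`).
No assumption on the rank of the projections along the curve is needed.

*The bound is attained.* After a change of the phase of `v`, the vectors `u` and `v` lie at angle `θ`
on a circle `cos φ u + sin φ w` with `u`, `w` orthonormal (`exists_phase_decomposition`). The arc
from `u` to `v`, traversed at speed `θ`, and the curve of the hyperplanes orthogonal to it both have
length at most `θ` (`fubiniStudyLength_circlePoint_le`, `grLength_circlePoint_le`).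

*The difference of the projections* `P_{Z_a} - P_{Z_b} = |v⟩⟨v| - |u⟩⟨u|` is `sin θ` times a
reflection of the plane of `u` and `w`. Hence its absolute value is `sin θ` times the projection onto
that plane (`abs_orthProj_hyperplane_sub`), which has norm `1` and trace `2`, and this gives the
operator norm and all Schatten norms.
-/

noncomputable section

namespace KernelGeometry

open scoped ContDiff ENNReal NNReal LinearAlgebra.Projectivization InnerProductSpace
open Filter Topology InnerProductSpace

/-! ### Growth along piecewise smooth curves -/

section Curves

variable {E : Type*} [NormedAddCommGroup E] [NormedSpace ℝ E]

theorem PiecewiseSmooth.of_contDiff {γ : ℝ → E} (h : ContDiff ℝ ∞ γ) : PiecewiseSmooth γ := by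
  refine ⟨1, fun i => (i : ℝ), fun i j hij => ?_, by simp, by simp, fun i => h.contDiffOn⟩
  exact Nat.cast_lt.2 hij

/-- The fundamental theorem of calculus as an inequality: `N` is a continuous integrand on the
tangent bundle and `G` a continuous function whose derivative along `γ` is at most `N`. -/
theorem PiecewiseSmooth.sub_le_integral {γ : ℝ → E} (hγ : PiecewiseSmooth γ) {N : E → E → ℝ}
    (hN : Continuous fun p : E × E => N p.1 p.2) {G : E → ℝ} (hG : Continuous G)
    (hd : ∀ t ∈ Set.Ioo (0 : ℝ) 1, ∀ v, HasDerivAt γ v t →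
      ∃ g', HasDerivAt (fun s => G (γ s)) g' t ∧ g' ≤ N (γ t) v) :
    G (γ 1) - G (γ 0) ≤ ∫ t in (0 : ℝ)..1, N (γ t) (deriv γ t) := by
  obtain ⟨n, τ, hτ, h0, h1, hs⟩ := hγ
  have key : ∀ j : Fin (n + 1),
      IntervalIntegrable (fun t => N (γ t) (deriv γ t)) MeasureTheory.volume 0 (τ j) ∧
      G (γ (τ j)) - G (γ 0) ≤ ∫ t in (0 : ℝ)..(τ j), N (γ t) (deriv γ t) := by
    intro j
    induction j using Fin.induction with
    | zero => simp [h0]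
    | succ i ih =>
      have hlt : τ i.castSucc < τ i.succ := hτ i.castSucc_lt_succ
      have hsub : Set.Ioo (τ i.castSucc) (τ i.succ) ⊆ Set.Ioo (0 : ℝ) 1 :=
        Set.Ioo_subset_Ioo (h0 ▸ hτ.monotone (Fin.zero_le _)) (h1 ▸ hτ.monotone (Fin.le_last _))
      have hdiff : ∀ t ∈ Set.Ioo (τ i.castSucc) (τ i.succ), HasDerivAt γ (deriv γ t) t :=
        fun t ht => (((hs i).differentiableOn (by simp)).differentiableAt
          (Icc_mem_nhds ht.1 ht.2)).hasDerivAt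
      -- On the open piece `deriv` is the one-sided derivative, which is continuous up to the ends.
      have hcont : ContinuousOn
          (fun t => N (γ t) (derivWithin γ (Set.Icc (τ i.castSucc) (τ i.succ)) t))
          (Set.Icc (τ i.castSucc) (τ i.succ)) :=
        hN.comp_continuousOn ((hs i).continuousOn.prodMk
          ((hs i).continuousOn_derivWithin (uniqueDiffOn_Icc hlt) (by simp)))
      have hint : IntervalIntegrable (fun t => N (γ t) (deriv γ t)) MeasureTheory.volume
          (τ i.castSucc) (τ i.succ) := by
        have h := hcont.intervalIntegrable_of_Icc (μ := MeasureTheory.volume) hlt.le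
        rw [intervalIntegrable_iff_integrableOn_Ioo_of_le hlt.le] at h ⊢
        refine h.congr_fun (fun t ht => ?_) measurableSet_Ioo
        simp only [derivWithin_of_mem_nhds (Icc_mem_nhds ht.1 ht.2)]
      have hpiece : G (γ (τ i.succ)) - G (γ (τ i.castSucc)) ≤
          ∫ t in (τ i.castSucc)..(τ i.succ), N (γ t) (deriv γ t) := by
        choose! g' hg' using fun t (ht : t ∈ Set.Ioo (τ i.castSucc) (τ i.succ)) =>
          hd t (hsub ht) _ (hdiff t ht)
        exact intervalIntegral.sub_le_integral_of_hasDeriv_right_of_le hlt.le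
          (hG.comp_continuousOn (hs i).continuousOn)
          (fun t ht => (hg' t ht).1.hasDerivWithinAt)
          ((intervalIntegrable_iff_integrableOn_Icc_of_le hlt.le).1 hint)
          (fun t ht => (hg' t ht).2)
      refine ⟨ih.1.trans hint, ?_⟩
      rw [← intervalIntegral.integral_add_adjacent_intervals ih.1 hint]
      linarith [ih.2]
  have := (key (Fin.last n)).2
  rwa [h1] at this

/-- If `ζ` starts at `1`, stays in `[-1, 1]` and changes at a rate of at most `2 N √(1 - ζ²)`, then
the angle `arccos ζ` grows by at most `2 ∫ N`. -/
theorem PiecewiseSmooth.arccos_le_integral {γ : ℝ → E} (hγ : PiecewiseSmooth γ) {N : E → E → ℝ}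
    (hN : Continuous fun p : E × E => N p.1 p.2) (hN0 : ∀ x v, 0 ≤ N x v)
    {ζ : E → ℝ} (hζ : Continuous ζ) (hζ1 : ∀ t ∈ Set.Icc (0 : ℝ) 1, ζ (γ t) ^ 2 ≤ 1)
    (hd : ∀ t ∈ Set.Ioo (0 : ℝ) 1, ∀ v, HasDerivAt γ v t →
      ∃ z', HasDerivAt (fun s => ζ (γ s)) z' t ∧ |z'| ≤ 2 * N (γ t) v * √(1 - ζ (γ t) ^ 2))
    (h0 : ζ (γ 0) = 1) :
    Real.arccos (ζ (γ 1)) ≤ 2 * ∫ t in (0 : ℝ)..1, N (γ t) (deriv γ t) := by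
  -- `arccos` is not differentiable at `±1`: apply the bound to `arccos (r ζ)` and let `r → 1`.
  have key : ∀ r ∈ Set.Ioo (0 : ℝ) 1, Real.arccos (r * ζ (γ 1)) - Real.arccos (r * ζ (γ 0)) ≤
      2 * ∫ t in (0 : ℝ)..1, N (γ t) (deriv γ t) := by
    intro r hr
    rw [← intervalIntegral.integral_const_mul]
    refine hγ.sub_le_integral (N := fun x v => 2 * N x v) (G := fun x => Real.arccos (r * ζ x))
      (hN.const_mul 2)
      (Real.continuous_arccos.comp (hζ.const_mul r)) fun t ht v hv => ?_
    obtain ⟨z', hz', hb⟩ := hd t ht v hv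
    have hz := hζ1 t (Set.Ioo_subset_Icc_self ht)
    set z := ζ (γ t) with hzdef
    have hr2 : r ^ 2 < 1 := by nlinarith [hr.1, hr.2]
    have hlt : (r * z) ^ 2 < 1 := by nlinarith [sq_nonneg z, sq_nonneg r, mul_pow r z 2]
    have hpos : 0 < √(1 - (r * z) ^ 2) := Real.sqrt_pos.2 (by linarith)
    have hder : HasDerivAt (fun s => Real.arccos (r * ζ (γ s)))
        (-(1 / √(1 - (r * z) ^ 2)) * (r * z')) t :=
      HasDerivAt.comp (h₂ := Real.arccos) (h := fun s => r * ζ (γ s)) t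
        (Real.hasDerivAt_arccos (by nlinarith) (by nlinarith))
        (hz'.const_mul r)
    refine ⟨_, hder, ?_⟩
    have hsq : √(1 - z ^ 2) ≤ √(1 - (r * z) ^ 2) :=
      Real.sqrt_le_sqrt (by nlinarith [sq_nonneg z, mul_pow r z 2])
    have hz'1 : -(r * z') ≤ 2 * N (γ t) v * √(1 - (r * z) ^ 2) :=
      calc -(r * z') ≤ r * |z'| := by nlinarith [neg_abs_le z', hr.1]
        _ ≤ |z'| := by nlinarith [abs_nonneg z', hr.2]
        _ ≤ _ := hb.trans (by gcongr; exact mul_nonneg zero_le_two (hN0 _ _))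
    have : -(1 / √(1 - (r * z) ^ 2)) * (r * z') = -(r * z') / √(1 - (r * z) ^ 2) := by ring
    rw [this]
    exact (div_le_iff₀ hpos).2 hz'1
  have hlim : Tendsto (fun r : ℝ => Real.arccos (r * ζ (γ 1)) - Real.arccos (r * ζ (γ 0)))
      (𝓝[<] 1) (𝓝 (Real.arccos (1 * ζ (γ 1)) - Real.arccos (1 * ζ (γ 0)))) := by
    refine Tendsto.mono_left (Continuous.tendsto ?_ 1) nhdsWithin_le_nhds
    exact (Real.continuous_arccos.comp (by fun_prop)).sub
      (Real.continuous_arccos.comp (by fun_prop))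
  have := le_of_tendsto hlim (by
    filter_upwards [Ioo_mem_nhdsLT (zero_lt_one' ℝ)] with r hr using key r hr)
  simpa [h0] using this

theorem arccos_two_mul_sq_sub_one {c : ℝ} (h0 : 0 ≤ c) (h1 : c ≤ 1) :
    Real.arccos (2 * c ^ 2 - 1) = 2 * Real.arccos c := by
  have hc : Real.cos (Real.arccos c) = c := Real.cos_arccos (by linarith) h1
  have := Real.arccos_le_pi_div_two.2 h0
  rw [← Real.arccos_cos (x := 2 * Real.arccos c) (by linarith [Real.arccos_nonneg c])
    (by linarith), Real.cos_two_mul, hc]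

end Curves

section

variable {H : Type*} [NormedAddCommGroup H] [InnerProductSpace ℂ H] [CompleteSpace H]

/-! ### Lower bound for the length of curves of subspaces -/

theorem orthProj_isIdempotentElem (S : ClosedSubmodule ℂ H) : orthProj S * orthProj S = orthProj S :=
  haveI : CompleteSpace S.toSubmodule := S.isClosed.completeSpace_coe
  S.toSubmodule.isIdempotentElem_starProjection

theorem orthProj_apply_apply (S : ClosedSubmodule ℂ H) (x : H) :
    orthProj S (orthProj S x) = orthProj S x :=
  DFunLike.congr_fun (orthProj_isIdempotentElem S) x

theorem inner_orthProj_left (S : ClosedSubmodule ℂ H) (x y : H) :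
    ⟪orthProj S x, y⟫_ℂ = ⟪x, orthProj S y⟫_ℂ :=
  haveI : CompleteSpace S.toSubmodule := S.isClosed.completeSpace_coe
  S.toSubmodule.starProjection_isSymmetric x y

theorem inner_orthProj_self (S : ClosedSubmodule ℂ H) (x : H) :
    ⟪x, orthProj S x⟫_ℂ = (‖orthProj S x‖ : ℂ) ^ 2 := by
  conv_lhs => rw [← orthProj_apply_apply, ← inner_orthProj_left, inner_self_eq_norm_sq_to_K]
  rfl

theorem norm_sub_orthProj_sq (S : ClosedSubmodule ℂ H) (x : H) :
    ‖x - orthProj S x‖ ^ 2 = ‖x‖ ^ 2 - ‖orthProj S x‖ ^ 2 := by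
  have h : RCLike.re ⟪x, orthProj S x⟫_ℂ = ‖orthProj S x‖ ^ 2 := by
    rw [inner_orthProj_self]
    norm_cast
  rw [norm_sub_sq (𝕜 := ℂ), h]
  ring

/-- A tangent vector `D` to the projections at `orthProj S` exchanges `S` and its orthogonal
complement, so that only the mixed terms of its quadratic form survive. -/
theorem norm_inner_tangent_le (S : ClosedSubmodule ℂ H) {D : H →L[ℂ] H}
    (hD : D * orthProj S + orthProj S * D = D) (u : H) :
    ‖⟪u, D u⟫_ℂ‖ ≤ 2 * ‖D‖ * (‖orthProj S u‖ * ‖u - orthProj S u‖) := by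
  set P := orthProj S with hP
  have hD' : ∀ x, D (P x) + P (D x) = D x := fun x => DFunLike.congr_fun hD x
  have hPq : P (u - P u) = 0 := by rw [map_sub, orthProj_apply_apply, sub_self]
  have h1 : ⟪P u, D (P u)⟫_ℂ = 0 := by
    have h := hD' (P u)
    rw [orthProj_apply_apply, add_eq_left] at h
    rw [inner_orthProj_left, h, inner_zero_right]
  have h2 : ⟪u - P u, D (u - P u)⟫_ℂ = 0 := by
    have h := hD' (u - P u)
    rw [hPq, map_zero, zero_add] at h
    rw [← h, ← inner_orthProj_left, hPq, inner_zero_left]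
  have hsum : ⟪u, D u⟫_ℂ = ⟪P u, D (u - P u)⟫_ℂ + ⟪u - P u, D (P u)⟫_ℂ := by
    have e : ⟪u, D u⟫_ℂ = ⟪P u + (u - P u), D (P u + (u - P u))⟫_ℂ := by
      rw [add_sub_cancel]
    rw [e, map_add, inner_add_left, inner_add_right, inner_add_right, h1, h2]
    ring
  have b1 : ‖⟪P u, D (u - P u)⟫_ℂ‖ ≤ ‖P u‖ * (‖D‖ * ‖u - P u‖) :=
    (norm_inner_le_norm _ _).trans (by gcongr; exact D.le_opNorm _)
  have b2 : ‖⟪u - P u, D (P u)⟫_ℂ‖ ≤ ‖u - P u‖ * (‖D‖ * ‖P u‖) :=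
    (norm_inner_le_norm _ _).trans (by gcongr; exact D.le_opNorm _)
  rw [hsum]
  refine (norm_add_le _ _).trans ?_
  linarith

/-- A curve of closed subspaces that starts orthogonally to the unit vector `u` and ends at `S` is at
least as long as the angle, `arccos ‖u - P_S u‖`, between `u` and the orthogonal complement of `S`. -/
theorem arccos_le_grLength {γ : ℝ → ClosedSubmodule ℂ H} (hγ : GrPiecewiseSmooth γ) {u : H}
    (hu : ‖u‖ = 1) (h0 : orthProj (γ 0) u = 0) :
    Real.arccos ‖u - orthProj (γ 1) u‖ ≤ grLength γ := by
  have hζ : ∀ S : ClosedSubmodule ℂ H,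
      1 - 2 * RCLike.re ⟪u, orthProj S u⟫_ℂ = 1 - 2 * ‖orthProj S u‖ ^ 2 := by
    intro S
    rw [inner_orthProj_self]
    norm_cast
  have hle : ∀ S : ClosedSubmodule ℂ H, ‖orthProj S u‖ ^ 2 ≤ 1 := by
    intro S
    have := norm_sub_orthProj_sq S u
    rw [hu] at this
    nlinarith [sq_nonneg ‖u - orthProj S u‖]
  have key := PiecewiseSmooth.arccos_le_integral (E := H →L[ℂ] H) hγ (N := fun _ D => ‖D‖)
    (by fun_prop) (fun _ _ => norm_nonneg _) (ζ := fun T => 1 - 2 * RCLike.re ⟪u, T u⟫_ℂ)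
    (by fun_prop) (fun t _ => ?_) (fun t _ D hD => ?_) (by simp [h0])
  · have e : (1 : ℝ) - 2 * RCLike.re ⟪u, orthProj (γ 1) u⟫_ℂ =
        2 * ‖u - orthProj (γ 1) u‖ ^ 2 - 1 := by
      rw [hζ, norm_sub_orthProj_sq, hu]
      ring
    have hn : ‖u - orthProj (γ 1) u‖ ≤ 1 := by
      have := norm_sub_orthProj_sq (γ 1) u
      rw [hu] at this
      nlinarith [sq_nonneg ‖orthProj (γ 1) u‖, norm_nonneg (u - orthProj (γ 1) u)]
    simp only [e, arccos_two_mul_sq_sub_one (norm_nonneg _) hn] at key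
    exact le_of_mul_le_mul_left key two_pos
  · simp only [hζ]
    nlinarith [hle (γ t), sq_nonneg ‖orthProj (γ t) u‖]
  · have hDu : HasDerivAt (fun s => orthProj (γ s) u) (D u) t := by
      have hL := ((ContinuousLinearMap.apply ℂ H u).restrictScalars ℝ).hasFDerivAt
        (x := orthProj (γ t)) |>.comp_hasDerivAt t hD
      exact hL
    have hre : HasDerivAt (fun s => RCLike.re ⟪u, orthProj (γ s) u⟫_ℂ) (RCLike.re ⟪u, D u⟫_ℂ) t := by
      have hL := ((RCLike.reCLM : ℂ →L[ℝ] ℝ) ∘L (innerSL ℂ u).restrictScalars ℝ).hasFDerivAt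
        (x := orthProj (γ t) u) |>.comp_hasDerivAt t hDu
      exact hL
    refine ⟨_, (hre.const_mul 2).const_sub 1, ?_⟩
    -- Differentiate `P * P = P`.
    have htan : D * orthProj (γ t) + orthProj (γ t) * D = D := by
      exact (hD.mul hD).unique (hD.congr_of_eventuallyEq
        (Eventually.of_forall fun s => orthProj_isIdempotentElem (γ s)))
    have hb := norm_inner_tangent_le (γ t) htan u
    have hs : √(1 - (1 - 2 * RCLike.re ⟪u, orthProj (γ t) u⟫_ℂ) ^ 2) =
        2 * (‖orthProj (γ t) u‖ * ‖u - orthProj (γ t) u‖) := by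
      rw [hζ, Real.sqrt_eq_iff_mul_self_eq]
      · have := norm_sub_orthProj_sq (γ t) u
        rw [hu] at this
        linear_combination (-4) * ‖orthProj (γ t) u‖ ^ 2 * this
      · nlinarith [hle (γ t), sq_nonneg ‖orthProj (γ t) u‖]
      · positivity
    rw [hs, abs_neg, abs_mul, abs_two]
    have := RCLike.abs_re_le_norm ⟪u, D u⟫_ℂ
    nlinarith

end

section

variable {H : Type*} [NormedAddCommGroup H] [InnerProductSpace ℂ H]

/-! ### Lower bound for the length of curves in projective space -/

theorem norm_sub_inner_smul_sq {x y : H} (hx : ‖x‖ = 1) :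
    ‖y - ⟪x, y⟫_ℂ • x‖ ^ 2 = ‖y‖ ^ 2 - ‖⟪x, y⟫_ℂ‖ ^ 2 := by
  have h : RCLike.re ⟪y, ⟪x, y⟫_ℂ • x⟫_ℂ = ‖⟪x, y⟫_ℂ‖ ^ 2 := by
    rw [inner_smul_right, inner_mul_symm_re_eq_norm, norm_mul, norm_inner_symm y x]
    ring
  rw [norm_sub_sq (𝕜 := ℂ), h, norm_smul, hx]
  ring

/-- If `Φ` moves on the unit sphere with velocity `v`, then the derivative `4 Re (conj β ⟪u, v⟫)` of
`2 |β|² - 1`, where `β = ⟪u, Φ⟫`, only sees the component of `v` orthogonal to `Φ`. -/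
theorem abs_re_conj_mul_inner_le {u x v : H} (hu : ‖u‖ = 1) (hx : ‖x‖ = 1)
    (hv : RCLike.re ⟪x, v⟫_ℂ = 0) :
    |RCLike.re ((starRingEnd ℂ) ⟪u, x⟫_ℂ * ⟪u, v⟫_ℂ)| ≤
      √(‖v‖ ^ 2 - ‖⟪v, x⟫_ℂ‖ ^ 2) * (‖⟪u, x⟫_ℂ‖ * √(1 - ‖⟪u, x⟫_ℂ‖ ^ 2)) := by
  set w := v - ⟪x, v⟫_ℂ • x with hw
  have hnw : √(‖v‖ ^ 2 - ‖⟪v, x⟫_ℂ‖ ^ 2) = ‖w‖ := by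
    rw [norm_inner_symm, ← norm_sub_inner_smul_sq hx, Real.sqrt_sq (norm_nonneg _)]
  have hnu : √(1 - ‖⟪u, x⟫_ℂ‖ ^ 2) = ‖u - ⟪x, u⟫_ℂ • x‖ := by
    have := norm_sub_inner_smul_sq (y := u) hx
    rw [hu, one_pow, norm_inner_symm x u] at this
    rw [← this, Real.sqrt_sq (norm_nonneg _)]
  have hxw : ⟪x, w⟫_ℂ = 0 := by
    rw [hw, inner_sub_right, inner_smul_right, inner_self_eq_norm_sq_to_K, hx]
    simp
  have huw : ⟪u, w⟫_ℂ = ⟪u - ⟪x, u⟫_ℂ • x, w⟫_ℂ := by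
    rw [inner_sub_left, inner_smul_left, hxw, mul_zero, sub_zero]
  have huv : ⟪u, v⟫_ℂ = ⟪x, v⟫_ℂ * ⟪u, x⟫_ℂ + ⟪u, w⟫_ℂ := by
    rw [hw, inner_sub_right, inner_smul_right]
    ring
  have hre : RCLike.re ((starRingEnd ℂ) ⟪u, x⟫_ℂ * ⟪u, v⟫_ℂ) =
      RCLike.re ((starRingEnd ℂ) ⟪u, x⟫_ℂ * ⟪u, w⟫_ℂ) := by
    rw [huv, mul_add, map_add]
    have e : (starRingEnd ℂ) ⟪u, x⟫_ℂ * (⟪x, v⟫_ℂ * ⟪u, x⟫_ℂ) =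
        ((‖⟪u, x⟫_ℂ‖ ^ 2 : ℝ) : ℂ) * ⟪x, v⟫_ℂ := by
      have := Complex.conj_mul' ⟪u, x⟫_ℂ
      push_cast
      linear_combination ⟪x, v⟫_ℂ * this
    have e0 : RCLike.re (((‖⟪u, x⟫_ℂ‖ ^ 2 : ℝ) : ℂ) * ⟪x, v⟫_ℂ) = 0 := by
      have := RCLike.re_ofReal_mul (K := ℂ) (‖⟪u, x⟫_ℂ‖ ^ 2) ⟪x, v⟫_ℂ
      rw [hv, mul_zero] at this
      exact this
    rw [e, e0, zero_add]
  rw [hre, hnw, hnu]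
  refine (RCLike.abs_re_le_norm _).trans ?_
  rw [norm_mul, RCLike.norm_conj, huw]
  have := norm_inner_le_norm (𝕜 := ℂ) (u - ⟪x, u⟫_ℂ • x) w
  nlinarith [norm_nonneg ⟪u, x⟫_ℂ]

/-- A curve on the unit sphere has at least the Fubini-Study length of the angle between the complex
lines of its ends. -/
theorem arccos_le_fubiniStudyLength {Φ : ℝ → H} (hΦ : PiecewiseSmooth Φ)
    (h1 : ∀ t ∈ Set.Icc (0 : ℝ) 1, ‖Φ t‖ = 1) :
    Real.arccos ‖⟪Φ 0, Φ 1⟫_ℂ‖ ≤ fubiniStudyLength Φ := by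
  have hu : ‖Φ 0‖ = 1 := h1 0 (by simp)
  set u := Φ 0 with hu0
  have hle : ∀ t ∈ Set.Icc (0 : ℝ) 1, ‖⟪u, Φ t⟫_ℂ‖ ≤ 1 := by
    intro t ht
    simpa [hu, h1 t ht] using norm_inner_le_norm (𝕜 := ℂ) u (Φ t)
  have key := PiecewiseSmooth.arccos_le_integral hΦ
    (N := fun x v => √(‖v‖ ^ 2 - ‖⟪v, x⟫_ℂ‖ ^ 2))
    (by fun_prop) (fun _ _ => Real.sqrt_nonneg _) (ζ := fun x => 2 * ‖⟪u, x⟫_ℂ‖ ^ 2 - 1)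
    (by fun_prop) (fun t ht => ?_) (fun t ht v hv => ?_) ?_
  · simp only [arccos_two_mul_sq_sub_one (norm_nonneg _) (hle 1 (by simp))] at key
    exact le_of_mul_le_mul_left key two_pos
  · have h2 : ‖⟪u, Φ t⟫_ℂ‖ ^ 2 ≤ 1 := pow_le_one₀ (norm_nonneg _) (hle t ht)
    nlinarith [sq_nonneg ‖⟪u, Φ t⟫_ℂ‖]
  · have hxv : RCLike.re ⟪Φ t, v⟫_ℂ = 0 := by
      have hc : HasDerivAt (fun s => ⟪Φ s, Φ s⟫_ℂ) 0 t := by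
        refine (hasDerivAt_const t (1 : ℂ)).congr_of_eventuallyEq ?_
        filter_upwards [Icc_mem_nhds ht.1 ht.2] with s hs
        rw [inner_self_eq_norm_sq_to_K, h1 s hs]
        simp
      have h := (hv.inner ℂ hv).unique hc
      have h' := congrArg RCLike.re h
      rw [map_add, inner_re_symm v, map_zero] at h'
      linarith
    have hin : HasDerivAt (fun s => ⟪u, Φ s⟫_ℂ) ⟪u, v⟫_ℂ t := by
      simpa using (hasDerivAt_const t u).inner ℂ hv
    refine ⟨_, (hin.norm_sq.const_mul 2).sub_const 1, ?_⟩
    have hb := abs_re_conj_mul_inner_le hu (h1 t (Set.Ioo_subset_Icc_self ht)) hxv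
    have hn := hle t (Set.Ioo_subset_Icc_self ht)
    have hs : √(1 - (2 * ‖⟪u, Φ t⟫_ℂ‖ ^ 2 - 1) ^ 2) =
        2 * (‖⟪u, Φ t⟫_ℂ‖ * √(1 - ‖⟪u, Φ t⟫_ℂ‖ ^ 2)) := by
      have h0 : 0 ≤ 1 - ‖⟪u, Φ t⟫_ℂ‖ ^ 2 := by nlinarith [norm_nonneg ⟪u, Φ t⟫_ℂ]
      have := Real.mul_self_sqrt h0
      rw [Real.sqrt_eq_iff_mul_self_eq]
      · linear_combination (-4 * ‖⟪u, Φ t⟫_ℂ‖ ^ 2) * this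
      · nlinarith [sq_nonneg ‖⟪u, Φ t⟫_ℂ‖]
      · positivity
    rw [mul_comm ((starRingEnd ℂ) _)] at hb
    have hb' : |(⟪u, v⟫_ℂ * (starRingEnd ℂ) ⟪u, Φ t⟫_ℂ).re| ≤ _ := hb
    rw [hs, Complex.inner, abs_mul, abs_mul, abs_two]
    linarith
  · simp only [← hu0, inner_self_eq_norm_sq_to_K, hu]
    norm_num

end

section

variable {H : Type*} [NormedAddCommGroup H] [InnerProductSpace ℂ H]

/-! ### The plane spanned by two unit vectors -/

/-- Two unit vectors `u`, `v` lie, after a change of the phase of `v`, at angle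
`arccos ‖⟪u, v⟫‖` in a real plane. When the vectors are dependent, `w` is `0`. -/
theorem exists_phase_decomposition {u v : H} (hu : ‖u‖ = 1) (hv : ‖v‖ = 1) :
    ∃ (z : ℂ) (w : H), ‖z‖ = 1 ∧ ⟪u, w⟫_ℂ = 0 ∧
      z • v = (‖⟪u, v⟫_ℂ‖ : ℂ) • u + (√(1 - ‖⟪u, v⟫_ℂ‖ ^ 2) : ℂ) • w ∧
      (‖w‖ = 1 ∨ ‖⟪u, v⟫_ℂ‖ = 1 ∧ w = 0) := by
  obtain ⟨z, hz, hzc⟩ : ∃ z : ℂ, ‖z‖ = 1 ∧ z * ⟪u, v⟫_ℂ = (‖⟪u, v⟫_ℂ‖ : ℂ) := by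
    have := RCLike.exists_norm_eq_mul_self ⟪u, v⟫_ℂ
    obtain ⟨z, hz, h⟩ := this
    exact ⟨z, hz, h.symm⟩
  set c := ‖⟪u, v⟫_ℂ‖ with hc
  have hc1 : c ≤ 1 := by simpa [hu, hv] using norm_inner_le_norm (𝕜 := ℂ) u v
  have hc2 : c ^ 2 ≤ 1 := pow_le_one₀ (norm_nonneg _) hc1
  have hin : ⟪u, z • v⟫_ℂ = (c : ℂ) := by rw [inner_smul_right, hzc]
  have hn : ‖z • v - (c : ℂ) • u‖ ^ 2 = 1 - c ^ 2 := by
    have := norm_sub_inner_smul_sq (y := z • v) hu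
    rw [hin, norm_smul, hz, hv, Complex.norm_real, norm_norm] at this
    simpa using this
  have hn' : ‖z • v - (c : ℂ) • u‖ = √(1 - c ^ 2) := by
    rw [← hn, Real.sqrt_sq (norm_nonneg _)]
  rcases eq_or_ne (√(1 - c ^ 2)) 0 with hs | hs
  · refine ⟨z, 0, hz, by simp, ?_, Or.inr ⟨?_, rfl⟩⟩
    · rw [hs, norm_eq_zero, sub_eq_zero] at hn'
      simpa using hn'
    · rw [Real.sqrt_eq_zero (by linarith)] at hs
      nlinarith [norm_nonneg ⟪u, v⟫_ℂ]
  · have hs' : ((√(1 - c ^ 2) : ℝ) : ℂ) ≠ 0 := by exact_mod_cast hs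
    refine ⟨z, (√(1 - c ^ 2) : ℂ)⁻¹ • (z • v - (c : ℂ) • u), hz, ?_, ?_, Or.inl ?_⟩
    · rw [inner_smul_right, inner_sub_right, hin, inner_smul_right, inner_self_eq_norm_sq_to_K, hu]
      simp
    · rw [smul_inv_smul₀ hs', add_sub_cancel]
    · rw [norm_smul, hn', norm_inv, Complex.norm_real, Real.norm_of_nonneg (Real.sqrt_nonneg _),
        inv_mul_cancel₀ hs]

/-- The point at angle `φ` of the circle through `u` and `w`. The coefficients are complex scalars, so
that the complex inner product applies; `circlePoint_eq` is the form for real differentiation. -/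
def circlePoint (u w : H) (φ : ℝ) : H := (Real.cos φ : ℂ) • u + (Real.sin φ : ℂ) • w

theorem inner_circlePoint {u w : H} (hu : ‖u‖ = 1) (hw : ‖w‖ = 1) (huw : ⟪u, w⟫_ℂ = 0) (φ ψ : ℝ) :
    ⟪circlePoint u w φ, circlePoint u w ψ⟫_ℂ = (Real.cos (φ - ψ) : ℂ) := by
  have hwu : ⟪w, u⟫_ℂ = 0 := inner_eq_zero_symm.1 huw
  simp only [circlePoint, inner_add_left, inner_add_right, inner_smul_left, inner_smul_right, huw,
    hwu, inner_self_eq_norm_sq_to_K, hu, hw, Real.cos_sub, Complex.conj_ofReal]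
  push_cast
  ring

theorem norm_circlePoint {u w : H} (hu : ‖u‖ = 1) (hw : ‖w‖ = 1) (huw : ⟪u, w⟫_ℂ = 0) (φ : ℝ) :
    ‖circlePoint u w φ‖ = 1 := by
  have h := inner_circlePoint hu hw huw φ φ
  rw [inner_self_eq_norm_sq_to_K, sub_self, Real.cos_zero] at h
  have h' : ‖circlePoint u w φ‖ ^ 2 = 1 := Complex.ofReal_injective (by simpa using h)
  exact (pow_eq_one_iff_of_nonneg (norm_nonneg _) two_ne_zero).1 h'

theorem circlePoint_eq (u w : H) :
    circlePoint u w = fun φ => Real.cos φ • u + Real.sin φ • w := by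
  ext φ
  simp only [circlePoint, Complex.coe_smul]

theorem contDiff_circlePoint (u w : H) : ContDiff ℝ ∞ (circlePoint u w) := by
  rw [circlePoint_eq]
  fun_prop

theorem hasDerivAt_circlePoint (u w : H) (φ : ℝ) :
    HasDerivAt (circlePoint u w) (circlePoint u w (φ + Real.pi / 2)) φ := by
  rw [circlePoint_eq]
  simp only [Real.cos_add_pi_div_two, Real.sin_add_pi_div_two]
  exact ((Real.hasDerivAt_cos φ).smul_const u).add ((Real.hasDerivAt_sin φ).smul_const w)

theorem rankOne_circlePoint (u w : H) (φ ψ : ℝ) :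
    rankOne ℂ (circlePoint u w φ) (circlePoint u w ψ) =
      (Real.cos φ * Real.cos ψ) • rankOne ℂ u u + (Real.cos φ * Real.sin ψ) • rankOne ℂ u w +
      (Real.sin φ * Real.cos ψ) • rankOne ℂ w u + (Real.sin φ * Real.sin ψ) • rankOne ℂ w w := by
  ext x
  simp only [circlePoint, rankOne_apply, inner_add_left, inner_smul_left, Complex.conj_ofReal,
    add_apply, smul_apply, ← Complex.coe_smul,
    Complex.ofReal_mul]
  module

theorem contDiff_rankOne_circlePoint (u w : H) :
    ContDiff ℝ ∞ fun φ => rankOne ℂ (circlePoint u w φ) (circlePoint u w φ) := by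
  simp only [rankOne_circlePoint]
  fun_prop

theorem hasDerivAt_rankOne_circlePoint (u w : H) (φ : ℝ) :
    HasDerivAt (fun φ => rankOne ℂ (circlePoint u w φ) (circlePoint u w φ))
      (rankOne ℂ (circlePoint u w φ) (circlePoint u w (φ + Real.pi / 2)) +
        rankOne ℂ (circlePoint u w (φ + Real.pi / 2)) (circlePoint u w φ)) φ := by
  simp only [rankOne_circlePoint]
  have hc := Real.hasDerivAt_cos φ
  have hs := Real.hasDerivAt_sin φ
  convert! ((((hc.mul hc).smul_const (rankOne ℂ u u)).add
    ((hc.mul hs).smul_const (rankOne ℂ u w))).add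
    ((hs.mul hc).smul_const (rankOne ℂ w u))).add
    ((hs.mul hs).smul_const (rankOne ℂ w w)) using 1
  simp only [Real.cos_add_pi_div_two, Real.sin_add_pi_div_two]
  module

end

section

variable {H : Type*} [NormedAddCommGroup H] [InnerProductSpace ℂ H] [CompleteSpace H]

/-- The orthogonal projection onto the span of `x` and `y`, if these are orthonormal. -/
def planeProj (x y : H) : H →L[ℂ] H := rankOne ℂ x x + rankOne ℂ y y

theorem isStarProjection_planeProj {x y : H} (hx : ‖x‖ = 1) (hy : ‖y‖ = 1) (hxy : ⟪x, y⟫_ℂ = 0) :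
    IsStarProjection (planeProj x y) := by
  have hyx : ⟪y, x⟫_ℂ = 0 := inner_eq_zero_symm.1 hxy
  refine (isStarProjection_rankOne_self hx).add (isStarProjection_rankOne_self hy) ?_
  ext z
  simp [hxy]

theorem norm_planeProj {x y : H} (hx : ‖x‖ = 1) (hy : ‖y‖ = 1) (hxy : ⟪x, y⟫_ℂ = 0) :
    ‖planeProj x y‖ = 1 := by
  refine le_antisymm (isStarProjection_planeProj hx hy hxy).norm_le ?_
  have h := (planeProj x y).le_opNorm x
  have e : planeProj x y x = x := by
    simp [planeProj, inner_eq_zero_symm.1 hxy, inner_self_eq_norm_sq_to_K, hx]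
  rwa [e, hx, mul_one] at h

/-- The operator exchanges `x` and `y`: its square is the projection onto their span. -/
theorem norm_rankOne_add_rankOne_le {x y : H} (hx : ‖x‖ = 1) (hy : ‖y‖ = 1) (hxy : ⟪x, y⟫_ℂ = 0) :
    ‖rankOne ℂ x y + rankOne ℂ y x‖ ≤ 1 := by
  have hyx : ⟪y, x⟫_ℂ = 0 := inner_eq_zero_symm.1 hxy
  have h : star (rankOne ℂ x y + rankOne ℂ y x) * (rankOne ℂ x y + rankOne ℂ y x) =
      planeProj x y := by
    rw [star_add, ContinuousLinearMap.star_eq_adjoint, ContinuousLinearMap.star_eq_adjoint,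
      adjoint_rankOne, adjoint_rankOne]
    ext z
    simp [planeProj, inner_add_right, inner_smul_right, hxy, hyx, inner_self_eq_norm_sq_to_K, hx, hy,
      add_comm]
  have h2 := CStarRing.norm_star_mul_self (x := rankOne ℂ x y + rankOne ℂ y x)
  rw [h, norm_planeProj hx hy hxy] at h2
  nlinarith [norm_nonneg (rankOne ℂ x y + rankOne ℂ y x)]

/-! ### Hyperplanes -/

/-- The closed subspace of the vectors orthogonal to `u`. -/
def hyperplane (u : H) : ClosedSubmodule ℂ H := ClosedSubmodule.comap (innerSL ℂ u) ⊥

omit [CompleteSpace H] in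
theorem mem_hyperplane {u x : H} : x ∈ hyperplane u ↔ ⟪u, x⟫_ℂ = 0 := by
  simp [hyperplane, ClosedSubmodule.mem_comap]

omit [CompleteSpace H] in
theorem hyperplane_smul {z : ℂ} (hz : z ≠ 0) (u : H) : hyperplane (z • u) = hyperplane u := by
  ext x
  simp [mem_hyperplane, hz]

theorem orthProj_hyperplane {u : H} (hu : ‖u‖ = 1) :
    orthProj (hyperplane u) = 1 - rankOne ℂ u u := by
  have : CompleteSpace (hyperplane u).toSubmodule := (hyperplane u).isClosed.completeSpace_coe
  ext x
  refine Submodule.eq_starProjection_of_mem_of_inner_eq_zero ?_ fun w hw => ?_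
  · refine mem_hyperplane.2 ?_
    simp [inner_self_eq_norm_sq_to_K, hu]
  · have : ⟪u, w⟫_ℂ = 0 := mem_hyperplane.1 hw
    simp [inner_smul_left, this]

/-! ### Geodesics -/

theorem hasDerivAt_const_mul_id (θ t : ℝ) : HasDerivAt (fun s : ℝ => θ * s) θ t := by
  simpa using (hasDerivAt_id t).const_mul θ

theorem intervalIntegral_zero_one_le {f : ℝ → ℝ} {C : ℝ} (hf0 : ∀ t, 0 ≤ f t) (hf : ∀ t, f t ≤ C) :
    ∫ t in (0 : ℝ)..1, f t ≤ C := by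
  have h := intervalIntegral.norm_integral_le_of_norm_le_const (a := 0) (b := 1) (f := f) (C := C)
    fun t _ => by rw [Real.norm_of_nonneg (hf0 t)]; exact hf t
  rw [sub_zero, abs_one, mul_one] at h
  exact (Real.le_norm_self _).trans h

omit [CompleteSpace H] in
theorem fubiniStudyLength_circlePoint_le {u w : H} (hu : ‖u‖ = 1) (hw : ‖w‖ = 1)
    (huw : ⟪u, w⟫_ℂ = 0) {θ : ℝ} (hθ : 0 ≤ θ) :
    fubiniStudyLength (fun t => circlePoint u w (θ * t)) ≤ θ := by
  refine intervalIntegral_zero_one_le (fun _ => Real.sqrt_nonneg _) fun t => ?_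
  have h : HasDerivAt (fun t => circlePoint u w (θ * t)) _ t :=
    (hasDerivAt_circlePoint u w (θ * t)).scomp t (hasDerivAt_const_mul_id θ t)
  rw [h.deriv, norm_smul, norm_circlePoint hu hw huw, mul_one, Real.norm_of_nonneg hθ]
  exact Real.sqrt_le_iff.2 ⟨hθ, sub_le_self _ (sq_nonneg _)⟩

theorem grPiecewiseSmooth_circlePoint {u w : H} (hu : ‖u‖ = 1) (hw : ‖w‖ = 1)
    (huw : ⟪u, w⟫_ℂ = 0) (θ : ℝ) :
    GrPiecewiseSmooth fun t => hyperplane (circlePoint u w (θ * t)) := by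
  refine PiecewiseSmooth.of_contDiff ?_
  simp only [orthProj_hyperplane (norm_circlePoint hu hw huw _)]
  exact contDiff_const.sub ((contDiff_rankOne_circlePoint u w).comp (contDiff_const.mul contDiff_id))

theorem grLength_circlePoint_le {u w : H} (hu : ‖u‖ = 1) (hw : ‖w‖ = 1)
    (huw : ⟪u, w⟫_ℂ = 0) {θ : ℝ} (hθ : 0 ≤ θ) :
    grLength (fun t => hyperplane (circlePoint u w (θ * t))) ≤ θ := by
  refine intervalIntegral_zero_one_le (fun _ => norm_nonneg _) fun t => ?_
  simp only [orthProj_hyperplane (norm_circlePoint hu hw huw _)]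
  have h : HasDerivAt (fun t => 1 - rankOne ℂ (circlePoint u w (θ * t)) (circlePoint u w (θ * t)))
      _ t := ((hasDerivAt_rankOne_circlePoint u w (θ * t)).scomp t
        (hasDerivAt_const_mul_id θ t)).const_sub 1
  rw [h.deriv, norm_neg, norm_smul, Real.norm_of_nonneg hθ]
  refine mul_le_of_le_one_right hθ (norm_rankOne_add_rankOne_le (norm_circlePoint hu hw huw _)
    (norm_circlePoint hu hw huw _) ?_)
  rw [inner_circlePoint hu hw huw]
  simp

/-- The Grassmannian distance of two hyperplanes is the angle between their normals. -/
theorem grDist_hyperplane {u v : H} (hu : ‖u‖ = 1) (hv : ‖v‖ = 1) :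
    grDist (hyperplane u) (hyperplane v) = Real.arccos ‖⟪u, v⟫_ℂ‖ := by
  have hc1 : ‖⟪u, v⟫_ℂ‖ ≤ 1 := by simpa [hu, hv] using norm_inner_le_norm (𝕜 := ℂ) u v
  have hlow : ∀ γ : ℝ → ClosedSubmodule ℂ H, GrPiecewiseSmooth γ → γ 0 = hyperplane u →
      γ 1 = hyperplane v → Real.arccos ‖⟪u, v⟫_ℂ‖ ≤ grLength γ := by
    intro γ hγ h0 h1
    have e0 : orthProj (γ 0) u = 0 := by
      rw [h0, orthProj_hyperplane hu]
      simp [inner_self_eq_norm_sq_to_K, hu]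
    have h := arccos_le_grLength hγ hu e0
    rw [h1, orthProj_hyperplane hv] at h
    simpa [norm_smul, hv, norm_inner_symm v u] using h
  obtain ⟨γ, hγ, h0, h1, hl⟩ : ∃ γ : ℝ → ClosedSubmodule ℂ H, GrPiecewiseSmooth γ ∧
      γ 0 = hyperplane u ∧ γ 1 = hyperplane v ∧ grLength γ ≤ Real.arccos ‖⟪u, v⟫_ℂ‖ := by
    obtain ⟨z, w, hz, huw, hzv, hw | ⟨hc, rfl⟩⟩ := exists_phase_decomposition hu hv
    · refine ⟨_, grPiecewiseSmooth_circlePoint hu hw huw _, ?_, ?_,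
        grLength_circlePoint_le hu hw huw (Real.arccos_nonneg _)⟩
      · simp [circlePoint]
      · have hz0 : z ≠ 0 := norm_ne_zero_iff.1 (hz ▸ one_ne_zero)
        simp only [mul_one]
        rw [circlePoint, Real.cos_arccos (by linarith [norm_nonneg ⟪u, v⟫_ℂ]) hc1,
          Real.sin_arccos, ← hzv, hyperplane_smul hz0]
    -- The vectors are dependent, so `w = 0` is not a unit vector: the curve is constant.
    · have hz0 : z ≠ 0 := norm_ne_zero_iff.1 (hz ▸ one_ne_zero)
      refine ⟨fun _ => hyperplane u, PiecewiseSmooth.of_contDiff contDiff_const, rfl, ?_, ?_⟩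
      · rw [← hyperplane_smul hz0 v, hzv, hc]
        simp
      · simpa [grLength] using Real.arccos_nonneg _
  refine IsLeast.csInf_eq ⟨⟨γ, hγ, h0, h1, le_antisymm (hlow γ hγ h0 h1) hl⟩, ?_⟩
  rintro _ ⟨γ, hγ, h0, h1, rfl⟩
  exact hlow γ hγ h0 h1

omit [CompleteSpace H] in
/-- The Fubini-Study distance of two lines is the angle between them. -/
theorem fubiniStudyDist_mk {u v : H} (hu : ‖u‖ = 1) (hv : ‖v‖ = 1) (hu0 : u ≠ 0) (hv0 : v ≠ 0) :
    fubiniStudyDist (Projectivization.mk ℂ u hu0) (Projectivization.mk ℂ v hv0) =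
      Real.arccos ‖⟪u, v⟫_ℂ‖ := by
  have hc1 : ‖⟪u, v⟫_ℂ‖ ≤ 1 := by simpa [hu, hv] using norm_inner_le_norm (𝕜 := ℂ) u v
  have hphase : ∀ {x y : H}, ‖x‖ = 1 → ‖y‖ = 1 → ∀ (hx0 : x ≠ 0) (hy0 : y ≠ 0),
      Projectivization.mk ℂ x hx0 = Projectivization.mk ℂ y hy0 →
      ∃ z : ℂ, ‖z‖ = 1 ∧ x = z • y := by
    intro x y hx hy hx0 hy0 h
    obtain ⟨z, hz⟩ := (Projectivization.mk_eq_mk_iff' ℂ x y hx0 hy0).1 h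
    refine ⟨z, ?_, hz.symm⟩
    rwa [← hz, norm_smul, hy, mul_one] at hx
  have hlow : ∀ (γ : ℝ → ℙ ℂ H) (Φ : ℝ → H), IsPiecewiseSmoothLift γ Φ →
      γ 0 = Projectivization.mk ℂ u hu0 → γ 1 = Projectivization.mk ℂ v hv0 →
      Real.arccos ‖⟪u, v⟫_ℂ‖ ≤ fubiniStudyLength Φ := by
    intro γ Φ hΦ h0 h1
    obtain ⟨n0, hne0, e0⟩ := hΦ.2 0 (by simp)
    obtain ⟨n1, hne1, e1⟩ := hΦ.2 1 (by simp)
    obtain ⟨z, hz, hzu⟩ := hphase n0 hu hne0 hu0 (e0.trans h0)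
    obtain ⟨z', hz', hzv⟩ := hphase n1 hv hne1 hv0 (e1.trans h1)
    have h := arccos_le_fubiniStudyLength hΦ.1 fun t ht => (hΦ.2 t ht).1
    rwa [hzu, hzv, inner_smul_left, inner_smul_right, norm_mul, norm_mul, RCLike.norm_conj, hz, hz',
      one_mul, one_mul] at h
  obtain ⟨γ, Φ, hΦ, h0, h1, hl⟩ : ∃ (γ : ℝ → ℙ ℂ H) (Φ : ℝ → H), IsPiecewiseSmoothLift γ Φ ∧
      γ 0 = Projectivization.mk ℂ u hu0 ∧ γ 1 = Projectivization.mk ℂ v hv0 ∧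
      fubiniStudyLength Φ ≤ Real.arccos ‖⟪u, v⟫_ℂ‖ := by
    obtain ⟨z, w, hz, huw, hzv, hw | ⟨hc, rfl⟩⟩ := exists_phase_decomposition hu hv
    · set θ := Real.arccos ‖⟪u, v⟫_ℂ‖ with hθ
      have hn : ∀ t, ‖circlePoint u w (θ * t)‖ = 1 := fun t => norm_circlePoint hu hw huw _
      have hne : ∀ t, circlePoint u w (θ * t) ≠ 0 := fun t =>
        norm_ne_zero_iff.1 (hn t ▸ one_ne_zero)
      refine ⟨fun t => Projectivization.mk ℂ _ (hne t), fun t => circlePoint u w (θ * t),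
        ⟨PiecewiseSmooth.of_contDiff ((contDiff_circlePoint u w).comp
          (contDiff_const.mul contDiff_id)), fun t _ => ⟨hn t, hne t, rfl⟩⟩, ?_, ?_,
        fubiniStudyLength_circlePoint_le hu hw huw (Real.arccos_nonneg _)⟩
      · refine (Projectivization.mk_eq_mk_iff' ℂ _ _ _ _).2 ⟨1, ?_⟩
        simp [circlePoint]
      · refine (Projectivization.mk_eq_mk_iff' ℂ _ _ _ _).2 ⟨z, ?_⟩
        rw [mul_one, circlePoint, hθ, Real.cos_arccos (by linarith [norm_nonneg ⟪u, v⟫_ℂ]) hc1,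
          Real.sin_arccos, ← hzv]
    -- The vectors are dependent, so `w = 0` is not a unit vector: the curve is constant.
    · refine ⟨fun _ => Projectivization.mk ℂ u hu0, fun _ => u,
        ⟨PiecewiseSmooth.of_contDiff contDiff_const, fun t _ => ⟨hu, hu0, rfl⟩⟩, rfl, ?_, ?_⟩
      · refine (Projectivization.mk_eq_mk_iff' ℂ _ _ _ _).2 ⟨z, ?_⟩
        rw [hzv, hc]
        simp
      · simpa [fubiniStudyLength] using Real.arccos_nonneg _
  refine IsLeast.csInf_eq ⟨⟨γ, Φ, hΦ, h0, h1, le_antisymm (hlow γ Φ hΦ h0 h1) hl⟩, ?_⟩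
  rintro _ ⟨γ, Φ, hΦ, h0, h1, rfl⟩
  exact hlow γ Φ hΦ h0 h1

end

section

variable {H : Type*} [NormedAddCommGroup H] [InnerProductSpace ℂ H] [CompleteSpace H]

/-! ### The difference of two hyperplane projections -/

omit [CompleteSpace H] in
theorem rankOne_mul_rankOne (x y z w : H) :
    rankOne ℂ x y * rankOne ℂ z w = ⟪y, z⟫_ℂ • rankOne ℂ x w :=
  rankOne_comp_rankOne x y z w

/-- The difference of the projections onto the hyperplanes orthogonal to `u` and to a point at angle
`φ` from it is `sin φ` times a reflection of the plane of `u` and `w`. -/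
theorem star_mul_self_rankOne_circlePoint_sub {u w : H} (hu : ‖u‖ = 1) (hw : ‖w‖ = 1)
    (huw : ⟪u, w⟫_ℂ = 0) (φ : ℝ) :
    star (rankOne ℂ (circlePoint u w φ) (circlePoint u w φ) - rankOne ℂ u u) *
      (rankOne ℂ (circlePoint u w φ) (circlePoint u w φ) - rankOne ℂ u u) =
      (Real.sin φ * Real.sin φ) • planeProj u w := by
  have hv := norm_circlePoint hu hw huw φ
  have hvv : ⟪circlePoint u w φ, circlePoint u w φ⟫_ℂ = 1 := by
    rw [inner_self_eq_norm_sq_to_K, hv]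
    simp
  have huu : ⟪u, u⟫_ℂ = 1 := by
    rw [inner_self_eq_norm_sq_to_K, hu]
    simp
  have h0 : circlePoint u w 0 = u := by simp [circlePoint]
  have huv : ⟪u, circlePoint u w φ⟫_ℂ = (Real.cos φ : ℂ) := by
    have := inner_circlePoint hu hw huw 0 φ
    rwa [h0, zero_sub, Real.cos_neg] at this
  have hvu : ⟪circlePoint u w φ, u⟫_ℂ = (Real.cos φ : ℂ) := by
    have := inner_circlePoint hu hw huw φ 0
    rwa [h0, sub_zero] at this
  have hvr := rankOne_circlePoint u w φ 0
  have hur := rankOne_circlePoint u w 0 φ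
  simp only [h0, Real.cos_zero, Real.sin_zero, mul_one, one_mul, mul_zero, zero_mul, zero_smul,
    add_zero] at hvr hur
  rw [star_sub, ContinuousLinearMap.star_eq_adjoint, ContinuousLinearMap.star_eq_adjoint,
    adjoint_rankOne, adjoint_rankOne, sub_mul, mul_sub, mul_sub, rankOne_mul_rankOne,
    rankOne_mul_rankOne, rankOne_mul_rankOne, rankOne_mul_rankOne, hvv, huu, huv, hvu, hvr, hur,
    rankOne_circlePoint, planeProj, one_smul, one_smul, Complex.coe_smul, Complex.coe_smul]
  have h1 : Real.cos φ * Real.cos φ = 1 - Real.sin φ * Real.sin φ := by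
    linear_combination Real.cos_sq_add_sin_sq φ
  simp only [smul_add, smul_smul, h1]
  module

/-- The absolute value of the difference of the two projections is `sin φ` times the projection onto
the plane of `u` and `w`. -/
theorem abs_orthProj_hyperplane_sub {u v w : H} (hu : ‖u‖ = 1) (hw : ‖w‖ = 1)
    (huw : ⟪u, w⟫_ℂ = 0) {z : ℂ} (hz : ‖z‖ = 1) {φ : ℝ} (hφ : 0 ≤ Real.sin φ)
    (hzv : z • v = circlePoint u w φ) :
    CFC.abs (orthProj (hyperplane u) - orthProj (hyperplane v)) =
      Real.sin φ • planeProj u w := by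
  have hE := isStarProjection_planeProj hu hw huw
  have hz0 : z ≠ 0 := norm_ne_zero_iff.1 (hz ▸ one_ne_zero)
  rw [← hyperplane_smul hz0 v, hzv, orthProj_hyperplane hu,
    orthProj_hyperplane (norm_circlePoint hu hw huw φ), sub_sub_sub_cancel_left]
  have hmul : Real.sin φ • planeProj u w * Real.sin φ • planeProj u w =
      (Real.sin φ * Real.sin φ) • planeProj u w := by
    rw [smul_mul_smul_comm, hE.isIdempotentElem]
  exact CFC.sqrt_unique (hmul.trans (star_mul_self_rankOne_circlePoint_sub hu hw huw φ).symm)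
    (smul_nonneg hφ hE.nonneg)

/-- Either the two hyperplanes agree, or the difference of their projections is, in absolute value,
`√(1 - |⟪u, v⟫|²)` times the projection onto a plane. -/
theorem orthProj_hyperplane_sub_cases {u v : H} (hu : ‖u‖ = 1) (hv : ‖v‖ = 1) :
    (∃ w, ‖w‖ = 1 ∧ ⟪u, w⟫_ℂ = 0 ∧ CFC.abs (orthProj (hyperplane u) - orthProj (hyperplane v)) =
      √(1 - ‖⟪u, v⟫_ℂ‖ ^ 2) • planeProj u w) ∨
    (‖⟪u, v⟫_ℂ‖ = 1 ∧ orthProj (hyperplane u) - orthProj (hyperplane v) = 0) := by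
  have hc1 : ‖⟪u, v⟫_ℂ‖ ≤ 1 := by simpa [hu, hv] using norm_inner_le_norm (𝕜 := ℂ) u v
  obtain ⟨z, w, hz, huw, hzv, hw | ⟨hc, rfl⟩⟩ := exists_phase_decomposition hu hv
  · refine Or.inl ⟨w, hw, huw, ?_⟩
    rw [← Real.sin_arccos]
    refine abs_orthProj_hyperplane_sub hu hw huw hz ?_ ?_
    · rw [Real.sin_arccos]
      exact Real.sqrt_nonneg _
    · rw [hzv, circlePoint, Real.cos_arccos (by linarith [norm_nonneg ⟪u, v⟫_ℂ]) hc1,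
        Real.sin_arccos]
  · refine Or.inr ⟨hc, ?_⟩
    have hz0 : z ≠ 0 := norm_ne_zero_iff.1 (hz ▸ one_ne_zero)
    rw [← hyperplane_smul hz0 v, hzv, hc]
    simp

theorem norm_orthProj_hyperplane_sub {u v : H} (hu : ‖u‖ = 1) (hv : ‖v‖ = 1) :
    ‖orthProj (hyperplane u) - orthProj (hyperplane v)‖ = √(1 - ‖⟪u, v⟫_ℂ‖ ^ 2) := by
  obtain ⟨w, hw, huw, h⟩ | ⟨hc, h⟩ := orthProj_hyperplane_sub_cases hu hv
  · rw [← CFC.norm_abs, h, norm_smul, norm_planeProj hu hw huw, mul_one,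
      Real.norm_of_nonneg (Real.sqrt_nonneg _)]
  · rw [h, hc]
    simp

/-! ### Schatten norms -/

/-- The spectrum of a projection lies in `{0, 1}`, and `0 ^ p = 0` as `p > 0`. -/
theorem rpow_smul_of_isStarProjection {E : H →L[ℂ] H} (hE : IsStarProjection E) {s p : ℝ}
    (hs : 0 ≤ s) (hp : 0 < p) : CFC.rpow (s • E) p = s ^ p • E := by
  lift s to ℝ≥0 using hs
  have hE0 := hE.nonneg
  have hspec : ∀ x ∈ spectrum ℝ≥0 E, x = 0 ∨ x = 1 := by
    intro x hx
    have h := hE.isIdempotentElem.spectrum_subset ℝ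
      (spectrum.algebraMap_mem ℝ hx)
    simpa using h
  have h1 : CFC.rpow ((s : ℝ) • E) p = cfc (fun x : ℝ≥0 => s ^ p * x) E := by
    change cfc (fun x : ℝ≥0 => x ^ p) (s • E) = _
    rw [← cfc_comp_smul s (fun x : ℝ≥0 => x ^ p) E
      (by exact (NNReal.continuous_rpow_const hp.le).continuousOn)]
    refine cfc_congr fun x hx => ?_
    rcases hspec x hx with rfl | rfl
    · simp [hp.ne']
    · simp
  rw [h1, cfc_const_mul_id _ _ hE0]
  rfl

/-- By Parseval's identity, each of the two unit vectors contributes `r` to the trace, in any Hilbert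
basis. -/
theorem posTrace_smul_planeProj {x y : H} (hx : ‖x‖ = 1) (hy : ‖y‖ = 1) {r : ℝ} (hr : 0 ≤ r) :
    posTrace (r • planeProj x y) = 2 * ENNReal.ofReal r := by
  obtain ⟨b, hb⟩ := (exists_hilbertBasis ℂ H).choose_spec
  have hsum : ∀ z : H, ‖z‖ = 1 → HasSum (fun i => r * ‖⟪b i, z⟫_ℂ‖ ^ 2) r := by
    intro z hz
    have h := (b.hasSum_inner_mul_inner z z).mapL (RCLike.reCLM : ℂ →L[ℝ] ℝ) |>.mul_left r
    have e : ∀ i, r * RCLike.reCLM (⟪z, b i⟫_ℂ * ⟪b i, z⟫_ℂ) = r * ‖⟪b i, z⟫_ℂ‖ ^ 2 := by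
      intro i
      rw [RCLike.reCLM_apply, inner_mul_symm_re_eq_norm, norm_mul, norm_inner_symm z, sq]
    have e' : r * RCLike.reCLM ⟪z, z⟫_ℂ = r := by
      rw [RCLike.reCLM_apply, inner_self_eq_norm_sq, hz, one_pow, mul_one]
    simpa only [e, e'] using h
  have hterm : ∀ i : (exists_hilbertBasis ℂ H).choose,
      (⟪(i : H), (r • planeProj x y) (i : H)⟫_ℂ).re =
      r * ‖⟪b i, x⟫_ℂ‖ ^ 2 + r * ‖⟪b i, y⟫_ℂ‖ ^ 2 := by
    intro i
    have e : ∀ z : H, (⟪z, b i⟫_ℂ * ⟪b i, z⟫_ℂ).re = ‖⟪b i, z⟫_ℂ‖ ^ 2 := by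
      intro z
      have := inner_mul_symm_re_eq_norm (𝕜 := ℂ) z (b i)
      rw [norm_mul, norm_inner_symm z, ← sq] at this
      exact this
    have hi : (i : H) = b i := by rw [hb]
    rw [hi, ← e, ← e, planeProj, ← Complex.coe_smul, smul_apply, add_apply, rankOne_apply,
      rankOne_apply, inner_smul_right, inner_add_right, inner_smul_right, inner_smul_right,
      Complex.re_ofReal_mul, Complex.add_re, mul_add]
  rw [posTrace]
  simp only [hterm]
  rw [← ENNReal.ofReal_tsum_of_nonneg (fun i => by positivity)
    ((hsum x hx).add (hsum y hy)).summable, ((hsum x hx).add (hsum y hy)).tsum_eq,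
    ENNReal.ofReal_add hr hr, two_mul]

theorem schattenNorm_orthProj_hyperplane_sub {u v : H} (hu : ‖u‖ = 1) (hv : ‖v‖ = 1) {p : ℝ}
    (hp : 0 < p) : schattenNorm p (orthProj (hyperplane u) - orthProj (hyperplane v)) =
      2 ^ (1 / p) * ENNReal.ofReal √(1 - ‖⟪u, v⟫_ℂ‖ ^ 2) := by
  rw [schattenNorm]
  obtain ⟨w, hw, huw, h⟩ | ⟨hc, h⟩ := orthProj_hyperplane_sub_cases hu hv
  · have hs := Real.sqrt_nonneg (1 - ‖⟪u, v⟫_ℂ‖ ^ 2)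
    rw [h, rpow_smul_of_isStarProjection (isStarProjection_planeProj hu hw huw) hs hp,
      posTrace_smul_planeProj hu hw (Real.rpow_nonneg hs p),
      ENNReal.mul_rpow_of_nonneg _ _ (by positivity), ← ENNReal.ofReal_rpow_of_nonneg hs hp.le,
      ← ENNReal.rpow_mul, mul_one_div_cancel hp.ne', ENNReal.rpow_one]
  · have h0 : CFC.rpow (0 : H →L[ℂ] H) p = 0 := by
      have := rpow_smul_of_isStarProjection (E := (0 : H →L[ℂ] H)) (.zero _) le_rfl hp
      rwa [smul_zero, smul_zero] at this
    rw [h, CFC.abs_zero, h0, hc]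
    simp [posTrace, hp]

end

section

variable {X : Type*} (H : Type*) [NormedAddCommGroup H] [InnerProductSpace ℂ H] [RKHS ℂ H X ℂ]
  [CompleteSpace H]

/-! ### Normalized reproducing kernels -/

/-- The normalized reproducing kernel `k_a / ‖k_a‖`. -/
def normalizedKer (a : X) : H := (‖ker H a‖ : ℂ)⁻¹ • ker H a

variable {H} {a b : X}

theorem norm_normalizedKer (ha : ker H a ≠ 0) : ‖normalizedKer H a‖ = 1 := by
  rw [normalizedKer, norm_smul, norm_inv, Complex.norm_real, norm_norm,
    inv_mul_cancel₀ (norm_ne_zero_iff.2 ha)]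

theorem norm_inner_normalizedKer :
    ‖⟪normalizedKer H a, normalizedKer H b⟫_ℂ‖ = cosAngle H a b := by
  rw [normalizedKer, normalizedKer, inner_smul_left, inner_smul_right, norm_mul, norm_mul,
    RCLike.norm_conj, norm_inv, norm_inv, Complex.norm_real, Complex.norm_real, norm_norm, norm_norm,
    cosAngle, div_eq_mul_inv, mul_inv]
  ring

theorem zeroSpace_eq_hyperplane (ha : ker H a ≠ 0) :
    zeroSpace H a = hyperplane (normalizedKer H a) := by
  have h : (‖ker H a‖ : ℂ)⁻¹ ≠ 0 := by simpa using ha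
  refine SetLike.ext fun f => ?_
  rw [normalizedKer, hyperplane_smul h, mem_hyperplane, inner_ker]
  rfl

theorem mk_ker_eq (ha : ker H a ≠ 0) (ha' : normalizedKer H a ≠ 0) :
    Projectivization.mk ℂ (ker H a) ha = Projectivization.mk ℂ (normalizedKer H a) ha' :=
  ((Projectivization.mk_eq_mk_iff' ℂ _ _ _ _).2 ⟨_, rfl⟩).symm

theorem cosAngle_nonneg : 0 ≤ cosAngle H a b := by
  rw [cosAngle]
  positivity

theorem cosAngle_le_one : cosAngle H a b ≤ 1 :=
  div_le_one_of_le₀ (norm_inner_le_norm _ _) (by positivity)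

theorem Gam_eq_arccos (ha : ker H a ≠ 0) (hb : ker H b ≠ 0) :
    Gam H a b = Real.arccos (cosAngle H a b) := by
  rw [Gam, zeroSpace_eq_hyperplane ha, zeroSpace_eq_hyperplane hb,
    grDist_hyperplane (norm_normalizedKer ha) (norm_normalizedKer hb), norm_inner_normalizedKer]

theorem kobayashi_eq_arccos (hk : ∀ a : X, ker H a ≠ 0) :
    kobayashi H hk a b = Real.arccos (cosAngle H a b) := by
  have hn : ∀ a : X, normalizedKer H a ≠ 0 := fun a =>
    norm_ne_zero_iff.1 (norm_normalizedKer (hk a) ▸ one_ne_zero)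
  rw [kobayashi, mk_ker_eq (hk a) (hn a), mk_ker_eq (hk b) (hn b),
    fubiniStudyDist_mk (norm_normalizedKer (hk a)) (norm_normalizedKer (hk b)),
    norm_inner_normalizedKer]

end

end KernelGeometry

end

open scoped ENNReal in
theorem theorem3p2 {X H : Type*} [NormedAddCommGroup H] [InnerProductSpace ℂ H] [CompleteSpace H]
    [RKHS ℂ H X ℂ] (hk : ∀ a : X, KernelGeometry.ker H a ≠ 0) (a b : X) :
    KernelGeometry.kobayashi H hk a b = KernelGeometry.Gam H a b ∧
    KernelGeometry.Gam H a b =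
      Real.arccos (‖inner ℂ (KernelGeometry.ker H a) (KernelGeometry.ker H b)‖ /
        (‖KernelGeometry.ker H a‖ * ‖KernelGeometry.ker H b‖)) ∧
    KernelGeometry.del H a b = Real.sin (KernelGeometry.Gam H a b) ∧
    Real.sin (KernelGeometry.Gam H a b) =
      ‖KernelGeometry.orthProj (KernelGeometry.zeroSpace H a) -
        KernelGeometry.orthProj (KernelGeometry.zeroSpace H b)‖ ∧
    (∀ p : ℝ, 1 ≤ p →
      ENNReal.ofReal ‖KernelGeometry.orthProj (KernelGeometry.zeroSpace H a) -
        KernelGeometry.orthProj (KernelGeometry.zeroSpace H b)‖ =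
      (2 : ℝ≥0∞) ^ (-(1 / p)) *
        KernelGeometry.schattenNorm p (KernelGeometry.orthProj (KernelGeometry.zeroSpace H a) -
          KernelGeometry.orthProj (KernelGeometry.zeroSpace H b))) ∧
    KernelGeometry.skwarczynski H a b = √2 * Real.sin (KernelGeometry.Gam H a b / 2) := by
  have hG := KernelGeometry.Gam_eq_arccos (hk a) (hk b)
  have hu := KernelGeometry.norm_normalizedKer (hk a)
  have hv := KernelGeometry.norm_normalizedKer (hk b)
  have hc0 := KernelGeometry.cosAngle_nonneg (H := H) (a := a) (b := b)
  have hc1 := KernelGeometry.cosAngle_le_one (H := H) (a := a) (b := b)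
  have hnorm := KernelGeometry.norm_orthProj_hyperplane_sub hu hv
  rw [KernelGeometry.norm_inner_normalizedKer] at hnorm
  rw [KernelGeometry.zeroSpace_eq_hyperplane (hk a), KernelGeometry.zeroSpace_eq_hyperplane (hk b)]
  refine ⟨(KernelGeometry.kobayashi_eq_arccos hk).trans hG.symm, hG, ?_, ?_, fun p hp => ?_, ?_⟩
  · rw [hG, Real.sin_arccos, KernelGeometry.del]
  · rw [hG, Real.sin_arccos, hnorm]
  · rw [KernelGeometry.schattenNorm_orthProj_hyperplane_sub hu hv (zero_lt_one.trans_le hp),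
      KernelGeometry.norm_inner_normalizedKer, hnorm, ← mul_assoc,
      ← ENNReal.rpow_add _ _ two_ne_zero ENNReal.ofNat_ne_top, neg_add_cancel, ENNReal.rpow_zero,
      one_mul]
  · rw [hG, Real.sin_half_eq_sqrt (Real.arccos_nonneg _)
      (by linarith [Real.arccos_le_pi (KernelGeometry.cosAngle H a b), Real.pi_pos]),
      Real.cos_arccos (by linarith) hc1, ← Real.sqrt_mul zero_le_two, KernelGeometry.skwarczynski]
    congr 1
    ring
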